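/- Let $\mathit{PAct}$ be a denumerable set of prioritized actions containing the silent action $\tau$, let $\delta\notin\mathit{PAct}$ and $\mathit{Act}=\mathit{PAct}\cup\{\delta\}$. Below, $\alpha$ ranges over $\mathit{PAct}$ and $\gamma$ over $\mathit{Act}$. Expressions, with $X$ ranging over a denumerable set of variables, are generated by $$E ::= \mathbf 0 \mid X \mid \gamma.E \mid E+E \mid \mathrm{rec}\,X.E \mid \mathrm{pri}(E)$$ and are taken up to renaming of bound variables; $E\{F/X\}$ is capture-avoiding substitution. A basic process is a closed expression without $\mathrm{pri}$. A variable $X$ is guarded in $E$ if each free occurrence of $X$ in $E$ lies within a subexpression $\gamma.F$ with $\gamma\neq\tau$, and it is serial in $E$ if no subexpression $\mathrm{pri}(F)$ of $E$ contains a free occurrence of $X$. An expression is guarded if, for each of its subexpressions $\mathrm{rec}\,X.E$, $X$ is guarded in $E$. Transitions are given by the following rules, where the negative premises are read by stratification ($\alpha$-transitions first, then $\delta$-transitions): (1) $\gamma.P\xrightarrow{\gamma}P$; (2) if $P\xrightarrow{\alpha}P'$, then $P+Q\xrightarrow{\alpha}P'$ and $Q+P\xrightarrow{\alpha}P'$;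 (3) if $P\xrightarrow{\delta}P'$ and $Q$ has no $\tau$-transition, then $P+Q\xrightarrow{\delta}P'$ and $Q+P\xrightarrow{\delta}P'$; (4) if $E\{\mathrm{rec}\,X.E/X\}\xrightarrow{\gamma}P'$, then $\mathrm{rec}\,X.E\xrightarrow{\gamma}P'$; (5) if $P\xrightarrow{\alpha}P'$, then $\mathrm{pri}(P)\xrightarrow{\alpha}P'$. Write $\Rightarrow^{\gamma}$ for $(\xrightarrow{\tau})^*\xrightarrow{\gamma}(\xrightarrow{\tau})^*$, write $\Rightarrow^{\hat\gamma}$ for $\Rightarrow^{\gamma}$ if $\gamma\neq\tau$, and for $(\xrightarrow{\tau})^*$ if $\gamma=\tau$. A relation $\beta$ on basic processes is a weak bisimulation if, whenever $(P,Q)\in\beta$, each $P\xrightarrow{\gamma}P'$ is matched by some $Q\Rightarrow^{\hat\gamma}Q'$ with $(P',Q')\in\beta$, and each $Q\xrightarrow{\gamma}Q'$ by some $P\Rightarrow^{\hat\gamma}P'$ with $(P',Q')\in\beta$. Write $P\approx Q$ if some weak bisimulation contains $(P,Q)$. Write $P\simeq Q$ (observational congruence) if each $P\xrightarrow{\gamma}P'$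 is matched by some $Q\Rightarrow^{\gamma}Q'$ with $P'\approx Q'$, and each $Q\xrightarrow{\gamma}Q'$ by some $P\Rightarrow^{\gamma}P'$ with $P'\approx Q'$. Let $\mathcal A\vdash E=F$ be provability by equational reasoning (reflexivity, symmetry, transitivity, and congruence for all operators, including $\mathrm{rec}$) from all instances of the following axioms and of the rule (Rec2): - (A1)–(A4): $E+F=F+E$; $(E+F)+G=E+(F+G)$; $E+E=E$; $E+\mathbf 0=E$. - (Tau1)–(Tau3): $\gamma.\tau.E=\gamma.E$; $E+\tau.E=\tau.E$; $\gamma.(E+\tau.F)+\gamma.F=\gamma.(E+\tau.F)$. - (Pri1)–(Pri6): $\mathrm{pri}(\mathbf 0)=\mathbf 0$; $\mathrm{pri}(\alpha.E)=\alpha.E$; $\mathrm{pri}(\delta.E)=\mathbf 0$; $\mathrm{pri}(E+F)=\mathrm{pri}(E)+\mathrm{pri}(F)$; $\mathrm{pri}(\mathrm{pri}(E))=\mathrm{pri}(E)$; $\tau.E+F=\tau.E+\mathrm{pri}(F)$. - (Rec1): $\mathrm{rec}\,X.E=E\{\mathrm{rec}\,X.E/X\}$. (Rec2): from $F=E\{F/X\}$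 infer $F=\mathrm{rec}\,X.E$, provided that $X$ is serial and guarded in $E$. - (Ung1)–(Ung4): $\mathrm{rec}\,X.(X+E)=\mathrm{rec}\,X.E$; $\mathrm{rec}\,X.(\tau.X+E)=\mathrm{rec}\,X.(\tau.\mathrm{pri}(E))$; $\mathrm{rec}\,X.(\tau.(X+E)+F)=\mathrm{rec}\,X.(\tau.X+E+F)$; $\mathrm{rec}\,X.(\tau.(\mathrm{pri}(X)+E)+F)=\mathrm{rec}\,X.(\tau.X+E+F)$. **Theorem.** If $P$ and $Q$ are guarded basic processes and $P\simeq Q$, then $\mathcal A\vdash P=Q$. -/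

import Mathlib

namespace PrioCalculus

/-- The denumerable set of prioritized actions: the silent action and the visible actions. -/
inductive PAct : Type
  | tau : PAct
  | vis : ℕ → PAct

/-- All actions: the prioritized ones, and the low priority action `δ`. -/
inductive Act : Type
  | prio : PAct → Act
  | delta : Act

/-- The silent action `τ`, as an element of `Act`. -/
abbrev Act.tau : Act := Act.prio PAct.tau

/-- Behavior expressions over the syntax `0 | X | γ.E | E + E | rec X.E | pri(E)`, up to renaming
of bound variables. Expressions are represented with de Bruijn indices: `var k` under `d` binders
is bound by one of them if `k < d`, and is the free variable number `k - d` otherwise;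
`fix E` is `rec X.E`, where `X` is the variable with index `0` of `E`. -/
inductive BExpr : Type
  | nil : BExpr
  | var : ℕ → BExpr
  | act : Act → BExpr → BExpr
  | sum : BExpr → BExpr → BExpr
  | fix : BExpr → BExpr
  | pri : BExpr → BExpr

namespace BExpr

/-- The variable `k` occurs free in the expression. -/
def FreeIn : ℕ → BExpr → Prop
  | _, nil => False
  | k, var j => j = k
  | k, act _ E => FreeIn k E
  | k, sum E F => FreeIn k E ∨ FreeIn k F
  | k, fix E => FreeIn (k + 1) E
  | k, pri E => FreeIn k E

/-- Closed expressions: no variable occurs free. -/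
def Closed (E : BExpr) : Prop := ∀ k, ¬ FreeIn k E

/-- Expressions of the basic syntax, without the auxiliary operator `pri`. -/
def Basic : BExpr → Prop
  | nil => True
  | var _ => True
  | act _ E => Basic E
  | sum E F => Basic E ∧ Basic F
  | fix E => Basic E
  | pri _ => False

/-- Extension of a renaming of variables below a binder. -/
def upRen (r : ℕ → ℕ) : ℕ → ℕ
  | 0 => 0
  | k + 1 => r k + 1

/-- Renaming of the free variables. -/
def rename : (ℕ → ℕ) → BExpr → BExpr
  | _, nil => nil
  | r, var k => var (r k)
  | r, act γ E => act γ (rename r E)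
  | r, sum E F => sum (rename r E) (rename r F)
  | r, fix E => fix (rename (upRen r) E)
  | r, pri E => pri (rename r E)

/-- Extension of a substitution below a binder. -/
def up (s : ℕ → BExpr) : ℕ → BExpr
  | 0 => var 0
  | k + 1 => rename Nat.succ (s k)

/-- Simultaneous capture-avoiding substitution for the free variables. -/
def subst : (ℕ → BExpr) → BExpr → BExpr
  | _, nil => nil
  | s, var k => s k
  | s, act γ E => act γ (subst s E)
  | s, sum E F => sum (subst s E) (subst s F)
  | s, fix E => fix (subst (up s) E)
  | s, pri E => pri (subst s E)

/-- The substitution that replaces the variable with index `0` by `F` and removes its binder. -/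
def single (F : BExpr) : ℕ → BExpr
  | 0 => F
  | k + 1 => var k

/-- `E{F/X}`, where `E` is the body of a recursion `rec X.E` (so `X` has index `0` in `E`). -/
def inst (E F : BExpr) : BExpr := subst (single F) E

/-- The variable `k` is (strongly) guarded in the expression: each free occurrence of it lies
within a subexpression `γ.F` with `γ ≠ τ`. -/
def GuardedVar : ℕ → BExpr → Prop
  | _, nil => True
  | k, var j => j ≠ k
  | k, act γ E => γ ≠ Act.tau ∨ GuardedVar k E
  | k, sum E F => GuardedVar k E ∧ GuardedVar k F
  | k, fix E => GuardedVar (k + 1) E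
  | k, pri E => GuardedVar k E

/-- An expression is (strongly) guarded if in each of its subexpressions `rec X.E`, the variable
`X` is (strongly) guarded in `E`. -/
def Guarded : BExpr → Prop
  | nil => True
  | var _ => True
  | act _ E => Guarded E
  | sum E F => Guarded E ∧ Guarded F
  | fix E => GuardedVar 0 E ∧ Guarded E
  | pri E => Guarded E

/-- The variable `k` is serial in the expression: each subexpression in which it occurs free,
apart from the variable itself, is a prefix, a sum or a recursion (so it is not some `pri(F)`). -/
def Serial : ℕ → BExpr → Prop
  | _, nil => True
  | _, var _ => True
  | k, act _ E => Serial k E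
  | k, sum E F => Serial k E ∧ Serial k F
  | k, fix E => Serial (k + 1) E
  | k, pri E => ¬ FreeIn k E

end BExpr

open BExpr

/-- Transitions labelled by prioritized actions. No rule for them has a negative premise, so they
form the first stratum of the operational semantics. -/
inductive PStep : BExpr → PAct → BExpr → Prop
  | act (α : PAct) (P : BExpr) : PStep (act (Act.prio α) P) α P
  | sumLeft {P Q P' : BExpr} {α : PAct} : PStep P α P' → PStep (sum P Q) α P'
  | sumRight {P Q Q' : BExpr} {α : PAct} : PStep Q α Q' → PStep (sum P Q) α Q'
  | fix {E P' : BExpr} {α : PAct} : PStep (inst E (fix E)) α P' → PStep (fix E) α P'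
  | pri {P P' : BExpr} {α : PAct} : PStep P α P' → PStep (pri P) α P'

/-- Transitions labelled by `δ`: the second stratum. In a sum they are pre-empted by `τ`
transitions of the other summand, and `pri(P)` has none. -/
inductive DStep : BExpr → BExpr → Prop
  | act (P : BExpr) : DStep (act Act.delta P) P
  | sumLeft {P Q P' : BExpr} :
      DStep P P' → (¬ ∃ Q', PStep Q PAct.tau Q') → DStep (sum P Q) P'
  | sumRight {P Q Q' : BExpr} :
      DStep Q Q' → (¬ ∃ P', PStep P PAct.tau P') → DStep (sum P Q) Q'
  | fix {E P' : BExpr} : DStep (inst E (fix E)) P' → DStep (fix E) P'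

/-- The transition relation of the operational semantics. -/
def Step (P : BExpr) : Act → BExpr → Prop
  | Act.prio α, P' => PStep P α P'
  | Act.delta, P' => DStep P P'

/-- Basic processes: the closed expressions of the basic syntax (without `pri`). -/
def Proc : Type := {E : BExpr // E.Closed ∧ E.Basic}

namespace Proc

/-- The transition relation on processes. -/
def Trans (P : Proc) (γ : Act) (P' : Proc) : Prop := Step P.1 γ P'.1

/-- Finite, possibly empty, sequences of `τ` transitions. -/
def TauStar : Proc → Proc → Prop := Relation.ReflTransGen (fun P Q => Trans P Act.tau Q)

/-- Weak transitions: `τ* γ τ*`. -/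
def Weak (P : Proc) (γ : Act) (Q : Proc) : Prop :=
  ∃ P' Q', TauStar P P' ∧ Trans P' γ Q' ∧ TauStar Q' Q

/-- The weak transition for `γ` if `γ ≠ τ`, and `τ*` if `γ = τ`. -/
def WeakHat (P : Proc) (γ : Act) (Q : Proc) : Prop :=
  (γ ≠ Act.tau ∧ Weak P γ Q) ∨ (γ = Act.tau ∧ TauStar P Q)

/-- Weak bisimulations. -/
def IsWeakBisim (β : Proc → Proc → Prop) : Prop :=
  ∀ P Q, β P Q →
    (∀ γ P', Trans P γ P' → ∃ Q', WeakHat Q γ Q' ∧ β P' Q') ∧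
    (∀ γ Q', Trans Q γ Q' → ∃ P', WeakHat P γ P' ∧ β P' Q')

/-- Weak bisimilarity `P ≈ Q`. -/
def WeakBisimilar (P Q : Proc) : Prop := ∃ β, IsWeakBisim β ∧ β P Q

/-- Observational congruence `P ≃ Q`. -/
def ObsCongr (P Q : Proc) : Prop :=
  (∀ γ P', Trans P γ P' → ∃ Q', Weak Q γ Q' ∧ WeakBisimilar P' Q') ∧
  (∀ γ Q', Trans Q γ Q' → ∃ P', Weak P γ P' ∧ WeakBisimilar P' Q')

end Proc

/-- Provable equality in the axiom system `𝒜`: the least congruence on expressions (with `pri`)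
that contains all instances of the axioms and is closed under the rule `rec2`. -/
inductive Provable : BExpr → BExpr → Prop
  | refl (E : BExpr) : Provable E E
  | symm {E F : BExpr} : Provable E F → Provable F E
  | trans {E F G : BExpr} : Provable E F → Provable F G → Provable E G
  | congrAct (γ : Act) {E F : BExpr} : Provable E F → Provable (act γ E) (act γ F)
  | congrSum {E E' F F' : BExpr} :
      Provable E E' → Provable F F' → Provable (sum E F) (sum E' F')
  | congrFix {E F : BExpr} : Provable E F → Provable (fix E) (fix F)
  | congrPri {E F : BExpr} : Provable E F → Provable (pri E) (pri F)
  | a1 (E F : BExpr) : Provable (sum E F) (sum F E)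
  | a2 (E F G : BExpr) : Provable (sum (sum E F) G) (sum E (sum F G))
  | a3 (E : BExpr) : Provable (sum E E) E
  | a4 (E : BExpr) : Provable (sum E nil) E
  | tau1 (γ : Act) (E : BExpr) : Provable (act γ (act Act.tau E)) (act γ E)
  | tau2 (E : BExpr) : Provable (sum E (act Act.tau E)) (act Act.tau E)
  | tau3 (γ : Act) (E F : BExpr) :
      Provable (sum (act γ (sum E (act Act.tau F))) (act γ F)) (act γ (sum E (act Act.tau F)))
  | pri1 : Provable (pri nil) nil
  | pri2 (α : PAct) (E : BExpr) : Provable (pri (act (Act.prio α) E)) (act (Act.prio α) E)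
  | pri3 (E : BExpr) : Provable (pri (act Act.delta E)) nil
  | pri4 (E F : BExpr) : Provable (pri (sum E F)) (sum (pri E) (pri F))
  | pri5 (E : BExpr) : Provable (pri (pri E)) (pri E)
  | pri6 (E F : BExpr) : Provable (sum (act Act.tau E) F) (sum (act Act.tau E) (pri F))
  | rec1 (E : BExpr) : Provable (fix E) (inst E (fix E))
  | rec2 {E F : BExpr} :
      Serial 0 E → GuardedVar 0 E → Provable F (inst E F) → Provable F (fix E)
  | ung1 (E : BExpr) : Provable (fix (sum (var 0) E)) (fix E)
  | ung2 (E : BExpr) :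
      Provable (fix (sum (act Act.tau (var 0)) E)) (fix (act Act.tau (pri E)))
  | ung3 (E F : BExpr) :
      Provable (fix (sum (act Act.tau (sum (var 0) E)) F))
        (fix (sum (sum (act Act.tau (var 0)) E) F))
  | ung4 (E F : BExpr) :
      Provable (fix (sum (act Act.tau (sum (pri (var 0)) E)) F))
        (fix (sum (sum (act Act.tau (var 0)) E) F))

end PrioCalculus

namespace PrioCalculus

open BExpr

namespace BExpr

/-! ### Substitution calculus -/

/-! Write `Summand E F` for provability of `E + F = F`; it is a preorder whose symmetric part is
provable equality, so each of `P`, `Q` only has to be shown a summand of the other.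

A guarded basic process is determined by its transitions. By (Tau2), (Tau3) and unfolding, every
weak transition `P ⇒^γ P'` yields a summand `γ.P'` of `P` (`Summand.of_weak`). Conversely `P` lies
below anything that has all prefixes `γ.P'` of its transitions as summands
(`Summand.of_forall_step`); a `δ` summand pre-empted in a sum is absorbed by the `τ` summand that
pre-empts it. It therefore suffices to derive `γ.P' = γ.Q'` whenever `P' ≈ Q'`.

For this, consider the bisimilar pairs of guarded components of `P'` and `Q'`. They are finitely
many and index a system of equations, given by jointly performed weak transitions, that both
processes solve (`Proc.provable_rep`). Inaction of one side is compensated by a `τ` prefix, which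
vanishes under `γ` by (Tau1). Guardedness excludes `τ` cycles, so repeated use of (Rec2) shows that
such a system has only one solution (`provable_of_solutions`). -/

theorem rename_eq_subst (E : BExpr) : ∀ r : ℕ → ℕ, rename r E = subst (fun k => var (r k)) E := by
  induction E with
  | nil => intro r; rfl
  | var k => intro r; rfl
  | act γ E ih => intro r; simp only [rename, subst, ih]
  | sum E F ihE ihF => intro r; simp only [rename, subst, ihE, ihF]
  | pri E ih => intro r; simp only [rename, subst, ih]
  | fix E ih =>
    intro r
    have h : (fun k => var (upRen r k)) = up fun k => var (r k) := by
      funext k; cases k <;> rfl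
    simp only [rename, subst, ih, h]

theorem subst_var (E : BExpr) : subst var E = E := by
  induction E with
  | nil => rfl
  | var k => rfl
  | act γ E ih => simp only [subst, ih]
  | sum E F ihE ihF => simp only [subst, ihE, ihF]
  | pri E ih => simp only [subst, ih]
  | fix E ih =>
    have h : up var = var := by funext k; cases k <;> rfl
    simp only [subst, h, ih]

theorem subst_rename (E : BExpr) :
    ∀ (s : ℕ → BExpr) (r : ℕ → ℕ), subst s (rename r E) = subst (fun k => s (r k)) E := by
  induction E with
  | nil => intro s r; rfl
  | var k => intro s r; rfl
  | act γ E ih => intro s r; simp only [rename, subst, ih]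
  | sum E F ihE ihF => intro s r; simp only [rename, subst, ihE, ihF]
  | pri E ih => intro s r; simp only [rename, subst, ih]
  | fix E ih =>
    intro s r
    have h : (fun k => up s (upRen r k)) = up fun k => s (r k) := by
      funext k; cases k <;> rfl
    simp only [rename, subst, ih, h]

theorem rename_rename (E : BExpr) (r r' : ℕ → ℕ) :
    rename r (rename r' E) = rename (fun k => r (r' k)) E := by
  rw [rename_eq_subst _ r, subst_rename, rename_eq_subst]

theorem rename_subst (E : BExpr) :
    ∀ (r : ℕ → ℕ) (s : ℕ → BExpr), rename r (subst s E) = subst (fun k => rename r (s k)) E := by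
  induction E with
  | nil => intro r s; rfl
  | var k => intro r s; rfl
  | act γ E ih => intro r s; simp only [rename, subst, ih]
  | sum E F ihE ihF => intro r s; simp only [rename, subst, ihE, ihF]
  | pri E ih => intro r s; simp only [rename, subst, ih]
  | fix E ih =>
    intro r s
    have h : (fun k => rename (upRen r) (up s k)) = up fun k => rename r (s k) := by
      funext k
      cases k with
      | zero => rfl
      | succ k =>
        simp only [up, rename_rename]
        rfl
    simp only [rename, subst, ih, h]

theorem subst_subst (E : BExpr) :
    ∀ s t : ℕ → BExpr, subst s (subst t E) = subst (fun k => subst s (t k)) E := by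
  induction E with
  | nil => intro s t; rfl
  | var k => intro s t; rfl
  | act γ E ih => intro s t; simp only [subst, ih]
  | sum E F ihE ihF => intro s t; simp only [subst, ihE, ihF]
  | pri E ih => intro s t; simp only [subst, ih]
  | fix E ih =>
    intro s t
    have h : (fun k => subst (up s) (up t k)) = up fun k => subst s (t k) := by
      funext k
      cases k with
      | zero => rfl
      | succ k =>
        simp only [up, rename_subst, subst_rename]
    simp only [subst, ih, h]

theorem subst_single_rename_succ (E F : BExpr) : subst (single F) (rename Nat.succ E) = E := by
  rw [subst_rename]
  exact subst_var E

/-- Extension of a substitution by a value for the variable `0`. -/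
def cons (F : BExpr) (s : ℕ → BExpr) : ℕ → BExpr
  | 0 => F
  | k + 1 => s k

/-- Instantiating the bound variable after substituting below its binder amounts to one simultaneous
substitution. This makes passing under a recursion the same as pushing a value on a stack. -/
theorem inst_subst_up (E F : BExpr) (s : ℕ → BExpr) :
    inst (subst (up s) E) F = subst (cons F s) E := by
  rw [inst, subst_subst]
  congr 1
  funext k
  cases k with
  | zero => rfl
  | succ k => exact subst_single_rename_succ _ _

theorem subst_inst (E F : BExpr) (s : ℕ → BExpr) :
    subst s (inst E F) = inst (subst (up s) E) (subst s F) := by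
  rw [inst_subst_up, inst, subst_subst]
  congr 1
  funext k
  cases k <;> rfl

/-! ### Syntactic predicates under substitution -/

theorem exists_of_freeIn_rename (E : BExpr) :
    ∀ (k : ℕ) (r : ℕ → ℕ), FreeIn k (rename r E) → ∃ j, FreeIn j E ∧ r j = k := by
  induction E with
  | nil => intro k r h; exact h.elim
  | var i => intro k r h; exact ⟨i, rfl, h⟩
  | act γ E ih => intro k r h; exact ih k r h
  | pri E ih => intro k r h; exact ih k r h
  | sum E F ihE ihF =>
    rintro k r (h | h)
    · obtain ⟨j, hj, hk⟩ := ihE k r h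
      exact ⟨j, Or.inl hj, hk⟩
    · obtain ⟨j, hj, hk⟩ := ihF k r h
      exact ⟨j, Or.inr hj, hk⟩
  | fix E ih =>
    intro k r h
    obtain ⟨j, hj, hk⟩ := ih _ _ h
    cases j with
    | zero => simp [upRen] at hk
    | succ j => exact ⟨j, hj, by simpa [upRen] using hk⟩

theorem exists_of_freeIn_subst (E : BExpr) :
    ∀ (k : ℕ) (s : ℕ → BExpr), FreeIn k (subst s E) → ∃ j, FreeIn j E ∧ FreeIn k (s j) := by
  induction E with
  | nil => intro k s h; exact h.elim
  | var i => intro k s h; exact ⟨i, rfl, h⟩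
  | act γ E ih => intro k s h; exact ih k s h
  | pri E ih => intro k s h; exact ih k s h
  | sum E F ihE ihF =>
    rintro k s (h | h)
    · obtain ⟨j, hj, hk⟩ := ihE k s h
      exact ⟨j, Or.inl hj, hk⟩
    · obtain ⟨j, hj, hk⟩ := ihF k s h
      exact ⟨j, Or.inr hj, hk⟩
  | fix E ih =>
    intro k s h
    obtain ⟨j, hj, hk⟩ := ih _ _ h
    cases j with
    | zero => simp [up, FreeIn] at hk
    | succ j =>
      obtain ⟨i, hi, hik⟩ := exists_of_freeIn_rename _ _ _ hk
      cases Nat.succ.inj hik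
      exact ⟨j, hj, hi⟩

theorem Closed.inst_fix {E : BExpr} (h : (fix E).Closed) : (inst E (fix E)).Closed := by
  intro k hk
  obtain ⟨j, hj, hjk⟩ := exists_of_freeIn_subst _ _ _ hk
  cases j with
  | zero => exact h _ hjk
  | succ j => exact h j hj

theorem Basic.rename {E : BExpr} : E.Basic → ∀ r : ℕ → ℕ, (rename r E).Basic := by
  induction E with
  | nil => intro h r; exact h
  | var i => intro h r; trivial
  | act γ E ih => intro h r; exact ih h r
  | pri E ih => intro h r; exact h.elim
  | sum E F ihE ihF => intro h r; exact ⟨ihE h.1 r, ihF h.2 r⟩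
  | fix E ih => intro h r; exact ih h _

theorem Basic.subst {E : BExpr} :
    E.Basic → ∀ s : ℕ → BExpr, (∀ k, (s k).Basic) → (subst s E).Basic := by
  induction E with
  | nil => intro h s _; exact h
  | var i => intro h s hs; exact hs i
  | act γ E ih => intro h s hs; exact ih h s hs
  | pri E ih => intro h s _; exact h.elim
  | sum E F ihE ihF => intro h s hs; exact ⟨ihE h.1 s hs, ihF h.2 s hs⟩
  | fix E ih =>
    intro h s hs
    refine ih h _ fun k => ?_
    cases k with
    | zero => trivial
    | succ k => exact (hs k).rename _

theorem Basic.inst_fix {E : BExpr} (h : (fix E).Basic) : (inst E (fix E)).Basic := by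
  refine Basic.subst (E := E) h _ fun k => ?_
  cases k with
  | zero => exact h
  | succ k => trivial

theorem Basic.serial {E : BExpr} : E.Basic → ∀ k, Serial k E := by
  induction E with
  | nil => intro _ _; trivial
  | var i => intro _ _; trivial
  | act γ E ih => intro h k; exact ih h k
  | pri E ih => intro h; exact h.elim
  | sum E F ihE ihF => intro h k; exact ⟨ihE h.1 k, ihF h.2 k⟩
  | fix E ih => intro h k; exact ih h _

/-! ### Guardedness under renaming, substitution and unfolding -/

theorem guardedVar_rename (E : BExpr) :
    ∀ (k : ℕ) (r : ℕ → ℕ), (∀ j, r j = k → GuardedVar j E) → GuardedVar k (rename r E) := by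
  induction E with
  | nil => intro k r _; trivial
  | var i => intro k r h hk; exact h i hk rfl
  | act γ E ih =>
    intro k r h
    by_cases hγ : γ = Act.tau
    · exact Or.inr (ih k r fun j hj => (h j hj).resolve_left (not_not_intro hγ))
    · exact Or.inl hγ
  | pri E ih => intro k r h; exact ih k r h
  | sum E F ihE ihF =>
    intro k r h
    exact ⟨ihE k r fun j hj => (h j hj).1, ihF k r fun j hj => (h j hj).2⟩
  | fix E ih =>
    intro k r h
    refine ih _ _ fun j hj => ?_
    cases j with
    | zero => simp [upRen] at hj
    | succ j => exact h j (by simpa [upRen] using hj)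

theorem guardedVar_subst (E : BExpr) :
    ∀ (k : ℕ) (s : ℕ → BExpr), (∀ j, GuardedVar j E ∨ GuardedVar k (s j)) →
      GuardedVar k (subst s E) := by
  induction E with
  | nil => intro k s _; trivial
  | var i => intro k s h; exact (h i).resolve_left fun hi => hi rfl
  | act γ E ih =>
    intro k s h
    by_cases hγ : γ = Act.tau
    · exact Or.inr (ih k s fun j => (h j).imp_left fun hj => hj.resolve_left (not_not_intro hγ))
    · exact Or.inl hγ
  | pri E ih => intro k s h; exact ih k s h
  | sum E F ihE ihF =>
    intro k s h
    exact ⟨ihE k s fun j => (h j).imp_left And.left, ihF k s fun j => (h j).imp_left And.right⟩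
  | fix E ih =>
    intro k s h
    refine ih _ _ fun j => ?_
    cases j with
    | zero => exact Or.inr (Nat.succ_ne_zero k).symm
    | succ j =>
      refine (h j).imp_right fun hj => guardedVar_rename _ _ _ fun i hi => ?_
      cases Nat.succ.inj hi
      exact hj

theorem guardedVar_zero_subst_up {E : BExpr} (h : GuardedVar 0 E) (s : ℕ → BExpr) :
    GuardedVar 0 (subst (up s) E) := by
  refine guardedVar_subst _ _ _ fun j => ?_
  cases j with
  | zero => exact Or.inl h
  | succ j => exact Or.inr (guardedVar_rename _ _ _ fun i hi => (Nat.succ_ne_zero i hi).elim)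

theorem Guarded.rename {E : BExpr} : E.Guarded → ∀ r : ℕ → ℕ, (rename r E).Guarded := by
  induction E with
  | nil => intro h r; exact h
  | var i => intro h r; trivial
  | act γ E ih => intro h r; exact ih h r
  | pri E ih => intro h r; exact ih h r
  | sum E F ihE ihF => intro h r; exact ⟨ihE h.1 r, ihF h.2 r⟩
  | fix E ih =>
    intro h r
    refine ⟨guardedVar_rename _ _ _ fun j hj => ?_, ih h.2 _⟩
    cases j with
    | zero => exact h.1
    | succ j => simp [upRen] at hj

theorem Guarded.subst {E : BExpr} :
    E.Guarded → ∀ s : ℕ → BExpr, (∀ k, (s k).Guarded) → (subst s E).Guarded := by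
  induction E with
  | nil => intro h s _; exact h
  | var i => intro h s hs; exact hs i
  | act γ E ih => intro h s hs; exact ih h s hs
  | pri E ih => intro h s hs; exact ih h s hs
  | sum E F ihE ihF => intro h s hs; exact ⟨ihE h.1 s hs, ihF h.2 s hs⟩
  | fix E ih =>
    intro h s hs
    refine ⟨guardedVar_zero_subst_up h.1 s, ih h.2 _ fun k => ?_⟩
    cases k with
    | zero => trivial
    | succ k => exact (hs k).rename _

theorem Guarded.inst_fix {E : BExpr} (h : (fix E).Guarded) : (inst E (fix E)).Guarded := by
  refine h.2.subst _ fun k => ?_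
  cases k with
  | zero => exact h
  | succ k => trivial

/-! ### A height that decreases along `τ` transitions and unfoldings -/

/-- The height of the part of an expression that is not below a prefix other than `τ`. -/
def unguardedHeight : BExpr → ℕ
  | nil => 0
  | var _ => 0
  | act (Act.prio PAct.tau) E => unguardedHeight E + 1
  | act _ _ => 0
  | sum E F => unguardedHeight E + unguardedHeight F + 1
  | fix E => unguardedHeight E + 1
  | pri E => unguardedHeight E + 1

theorem unguardedHeight_rename (E : BExpr) :
    ∀ r : ℕ → ℕ, unguardedHeight (rename r E) = unguardedHeight E := by
  induction E with
  | nil => intro r; rfl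
  | var i => intro r; rfl
  | act γ E ih => intro r; rcases γ with (_ | _) | _ <;> simp [rename, unguardedHeight, ih]
  | pri E ih => intro r; simp [rename, unguardedHeight, ih]
  | sum E F ihE ihF => intro r; simp [rename, unguardedHeight, ihE, ihF]
  | fix E ih => intro r; simp [rename, unguardedHeight, ih]

/-- Guarded occurrences lie below visible or `δ` prefixes, where the height does not look, so their
values are irrelevant; any other occurrence already counts as `0`. -/
theorem unguardedHeight_subst (E : BExpr) :
    ∀ s : ℕ → BExpr, (∀ j, GuardedVar j E ∨ unguardedHeight (s j) = 0) →
      unguardedHeight (subst s E) = unguardedHeight E := by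
  induction E with
  | nil => intro s _; rfl
  | var i => intro s h; exact (h i).resolve_left fun hi => hi rfl
  | act γ E ih =>
    intro s h
    rcases γ with (_ | _) | _
    · simp only [subst, unguardedHeight]
      rw [ih s fun j => (h j).imp_left fun hj => hj.resolve_left (not_not_intro rfl)]
    · rfl
    · rfl
  | pri E ih => intro s h; simp only [subst, unguardedHeight]; rw [ih s h]
  | sum E F ihE ihF =>
    intro s h
    simp only [subst, unguardedHeight]
    rw [ihE s fun j => (h j).imp_left And.left, ihF s fun j => (h j).imp_left And.right]
  | fix E ih =>
    intro s h
    simp only [subst, unguardedHeight]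
    rw [ih]
    intro j
    cases j with
    | zero => exact Or.inr rfl
    | succ j => exact (h j).imp_right fun hj => (unguardedHeight_rename _ _).trans hj

theorem unguardedHeight_inst_fix {E : BExpr} (h : (fix E).Guarded) :
    unguardedHeight (inst E (fix E)) < unguardedHeight (fix E) := by
  rw [inst, unguardedHeight_subst]
  · exact Nat.lt_succ_self _
  · intro j
    cases j with
    | zero => exact Or.inl h.1
    | succ j => exact Or.inr rfl

end BExpr

/-! ### Sets of expressions closed under components -/

/-- Sets of expressions that contain the components of their elements, where the component of a
recursion is its unfolding. -/
structure ComponentClosed (I : Set BExpr) : Prop where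
  act : ∀ {γ E}, BExpr.act γ E ∈ I → E ∈ I
  sumLeft : ∀ {E F}, sum E F ∈ I → E ∈ I
  sumRight : ∀ {E F}, sum E F ∈ I → F ∈ I
  fix : ∀ {E}, BExpr.fix E ∈ I → inst E (BExpr.fix E) ∈ I
  pri : ∀ {E}, BExpr.pri E ∈ I → E ∈ I

namespace ComponentClosed

variable {I J : Set BExpr}

theorem union (hI : ComponentClosed I) (hJ : ComponentClosed J) : ComponentClosed (I ∪ J) where
  act := Or.imp hI.act hJ.act
  sumLeft := Or.imp hI.sumLeft hJ.sumLeft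
  sumRight := Or.imp hI.sumRight hJ.sumRight
  fix := Or.imp hI.fix hJ.fix
  pri := Or.imp hI.pri hJ.pri

theorem inter (hI : ComponentClosed I) (hJ : ComponentClosed J) : ComponentClosed (I ∩ J) where
  act := And.imp hI.act hJ.act
  sumLeft := And.imp hI.sumLeft hJ.sumLeft
  sumRight := And.imp hI.sumRight hJ.sumRight
  fix := And.imp hI.fix hJ.fix
  pri := And.imp hI.pri hJ.pri

theorem setOf_closed : ComponentClosed {E | E.Closed} where
  act h := h
  sumLeft h k hk := h k (Or.inl hk)
  sumRight h k hk := h k (Or.inr hk)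
  fix h := Closed.inst_fix h
  pri h := h

theorem setOf_basic : ComponentClosed {E | E.Basic} where
  act h := h
  sumLeft h := h.1
  sumRight h := h.2
  fix h := Basic.inst_fix h
  pri h := h.elim

theorem setOf_guarded : ComponentClosed {E | E.Guarded} where
  act h := h
  sumLeft h := h.1
  sumRight h := h.2
  fix h := Guarded.inst_fix h
  pri h := h

/-- Keeping the prefix together with the derivative lets a finite component-closed set bound the
labels as well as the reachable expressions. -/
theorem act_mem_of_pStep (hI : ComponentClosed I) {P P' : BExpr} {α : PAct}
    (h : PStep P α P') : P ∈ I → BExpr.act (Act.prio α) P' ∈ I := by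
  induction h with
  | act α P => exact id
  | sumLeft _ ih => exact fun hP => ih (hI.sumLeft hP)
  | sumRight _ ih => exact fun hP => ih (hI.sumRight hP)
  | fix _ ih => exact fun hP => ih (hI.fix hP)
  | pri _ ih => exact fun hP => ih (hI.pri hP)

theorem act_mem_of_dStep (hI : ComponentClosed I) {P P' : BExpr}
    (h : DStep P P') : P ∈ I → BExpr.act Act.delta P' ∈ I := by
  induction h with
  | act P => exact id
  | sumLeft _ _ ih => exact fun hP => ih (hI.sumLeft hP)
  | sumRight _ _ ih => exact fun hP => ih (hI.sumRight hP)
  | fix _ ih => exact fun hP => ih (hI.fix hP)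

theorem act_mem_of_step (hI : ComponentClosed I) {P P' : BExpr} {γ : Act}
    (h : Step P γ P') (hP : P ∈ I) : BExpr.act γ P' ∈ I := by
  cases γ with
  | prio α => exact hI.act_mem_of_pStep h hP
  | delta => exact hI.act_mem_of_dStep h hP

theorem mem_of_step (hI : ComponentClosed I) {P P' : BExpr} {γ : Act}
    (h : Step P γ P') (hP : P ∈ I) : P' ∈ I :=
  hI.act (hI.act_mem_of_step h hP)

theorem mem_of_tauStar (hI : ComponentClosed I) {P Q : Proc} (h : Proc.TauStar P Q)
    (hP : P.1 ∈ I) : Q.1 ∈ I := by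
  induction h with
  | refl => exact hP
  | tail _ h ih => exact hI.mem_of_step h ih

theorem mem_of_weak (hI : ComponentClosed I) {P Q : Proc} {γ : Act} (h : Proc.Weak P γ Q)
    (hP : P.1 ∈ I) : Q.1 ∈ I ∧ ∃ E, BExpr.act γ E ∈ I := by
  obtain ⟨P', Q', h₁, h₂, h₃⟩ := h
  have hP' := hI.mem_of_tauStar h₁ hP
  exact ⟨hI.mem_of_tauStar h₃ (hI.mem_of_step h₂ hP'), Q'.1, hI.act_mem_of_step h₂ hP'⟩

theorem insert_act (hI : ComponentClosed I) {γ : Act} {E : BExpr} (hE : E ∈ I) :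
    ComponentClosed (insert (BExpr.act γ E) I) where
  act := by
    rintro γ F (h | h)
    · cases h; exact Or.inr hE
    · exact Or.inr (hI.act h)
  sumLeft := by rintro _ _ (h | h); exacts [(by cases h), Or.inr (hI.sumLeft h)]
  sumRight := by rintro _ _ (h | h); exacts [(by cases h), Or.inr (hI.sumRight h)]
  fix := by rintro _ (h | h); exacts [(by cases h), Or.inr (hI.fix h)]
  pri := by rintro _ (h | h); exacts [(by cases h), Or.inr (hI.pri h)]

theorem insert_sum (hI : ComponentClosed I) {E F : BExpr} (hE : E ∈ I) (hF : F ∈ I) :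
    ComponentClosed (insert (sum E F) I) where
  act := by rintro _ _ (h | h); exacts [(by cases h), Or.inr (hI.act h)]
  sumLeft := by
    rintro _ _ (h | h)
    · cases h; exact Or.inr hE
    · exact Or.inr (hI.sumLeft h)
  sumRight := by
    rintro _ _ (h | h)
    · cases h; exact Or.inr hF
    · exact Or.inr (hI.sumRight h)
  fix := by rintro _ (h | h); exacts [(by cases h), Or.inr (hI.fix h)]
  pri := by rintro _ (h | h); exacts [(by cases h), Or.inr (hI.pri h)]

theorem insert_pri (hI : ComponentClosed I) {E : BExpr} (hE : E ∈ I) :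
    ComponentClosed (insert (BExpr.pri E) I) where
  act := by rintro _ _ (h | h); exacts [(by cases h), Or.inr (hI.act h)]
  sumLeft := by rintro _ _ (h | h); exacts [(by cases h), Or.inr (hI.sumLeft h)]
  sumRight := by rintro _ _ (h | h); exacts [(by cases h), Or.inr (hI.sumRight h)]
  fix := by rintro _ (h | h); exacts [(by cases h), Or.inr (hI.fix h)]
  pri := by
    rintro _ (h | h)
    · cases h; exact Or.inr hE
    · exact Or.inr (hI.pri h)

theorem singleton_nil : ComponentClosed {nil} := by
  constructor <;> intros <;> rename_i h <;> cases h

theorem singleton_var (k : ℕ) : ComponentClosed {var k} := by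
  constructor <;> intros <;> rename_i h <;> cases h

/-- The components of `rec X.E` are those of `E` with `rec X.E` put for `X`: unfolding an inner
recursion commutes with that substitution, so no further expressions arise. -/
theorem insert_fix (hI : ComponentClosed I) {E : BExpr} (hE : E ∈ I) :
    ComponentClosed (insert (BExpr.fix E) ((fun G => inst G (BExpr.fix E)) '' I)) where
  act := by
    rintro γ F (h | ⟨G, hG, h⟩)
    · cases h
    · rcases G with _ | (_ | k) | _ | _ | _ | _ <;> cases h
      exact Or.inr ⟨_, hI.act hG, rfl⟩
  sumLeft := by
    rintro _ _ (h | ⟨G, hG, h⟩)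
    · cases h
    · rcases G with _ | (_ | k) | _ | _ | _ | _ <;> cases h
      exact Or.inr ⟨_, hI.sumLeft hG, rfl⟩
  sumRight := by
    rintro _ _ (h | ⟨G, hG, h⟩)
    · cases h
    · rcases G with _ | (_ | k) | _ | _ | _ | _ <;> cases h
      exact Or.inr ⟨_, hI.sumRight hG, rfl⟩
  fix := by
    rintro F (h | ⟨G, hG, h⟩)
    · cases h
      exact Or.inr ⟨_, hE, rfl⟩
    -- Two shapes of `G` survive: the variable `X` itself, which has become `rec X.E`, and a
    -- recursion inside `E`.
    · rcases G with _ | (_ | k) | _ | _ | _ | _ <;> cases h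
      · exact Or.inr ⟨_, hE, rfl⟩
      · exact Or.inr ⟨_, hI.fix hG, subst_inst _ _ _⟩
  pri := by
    rintro _ (h | ⟨G, hG, h⟩)
    · cases h
    · rcases G with _ | (_ | k) | _ | _ | _ | _ <;> cases h
      exact Or.inr ⟨_, hI.pri hG, rfl⟩

theorem exists_finite (E : BExpr) : ∃ I : Set BExpr, I.Finite ∧ E ∈ I ∧ ComponentClosed I := by
  induction E with
  | nil => exact ⟨_, Set.finite_singleton _, rfl, singleton_nil⟩
  | var k => exact ⟨_, Set.finite_singleton _, rfl, singleton_var k⟩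
  | act γ E ih =>
    obtain ⟨I, hf, hE, hI⟩ := ih
    exact ⟨_, hf.insert _, Set.mem_insert _ _, hI.insert_act hE⟩
  | pri E ih =>
    obtain ⟨I, hf, hE, hI⟩ := ih
    exact ⟨_, hf.insert _, Set.mem_insert _ _, hI.insert_pri hE⟩
  | sum E F ihE ihF =>
    obtain ⟨I, hf, hE, hI⟩ := ihE
    obtain ⟨J, hg, hF, hJ⟩ := ihF
    exact ⟨_, (hf.union hg).insert _, Set.mem_insert _ _,
      (hI.union hJ).insert_sum (Or.inl hE) (Or.inr hF)⟩
  | fix E ih =>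
    obtain ⟨I, hf, hE, hI⟩ := ih
    exact ⟨_, (hf.image _).insert _, Set.mem_insert _ _, hI.insert_fix hE⟩

end ComponentClosed

theorem PStep.unguardedHeight_lt {P P' : BExpr} {α : PAct} (h : PStep P α P') :
    α = PAct.tau → P.Guarded → unguardedHeight P' < unguardedHeight P := by
  induction h with
  | act α P => rintro rfl _; exact Nat.lt_succ_self _
  | sumLeft _ ih => intro hα hP; have := ih hα hP.1; simp only [unguardedHeight]; omega
  | sumRight _ ih => intro hα hP; have := ih hα hP.2; simp only [unguardedHeight]; omega
  | fix _ ih => intro hα hP; exact (ih hα hP.inst_fix).trans (unguardedHeight_inst_fix hP)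
  | pri _ ih => intro hα hP; have := ih hα hP; simp only [unguardedHeight]; omega

/-! ### The summand preorder -/

/-- `E` is provably a summand of `F`. -/
def Summand (E F : BExpr) : Prop := Provable (sum E F) F

namespace Summand

variable {E F G : BExpr}

theorem refl (E : BExpr) : Summand E E := Provable.a3 E

theorem trans (h₁ : Summand E F) (h₂ : Summand F G) : Summand E G :=
  ((Provable.refl E).congrSum h₂.symm).trans <|
    (Provable.a2 E F G).symm.trans <| (Provable.congrSum h₁ (.refl G)).trans h₂

theorem of_provable (h : Provable E F) : Summand E F :=
  (h.congrSum (.refl F)).trans (.a3 F)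

theorem antisymm (h₁ : Summand E F) (h₂ : Summand F E) : Provable E F :=
  (Provable.symm h₂).trans ((Provable.a1 F E).trans h₁)

theorem sum (h₁ : Summand E G) (h₂ : Summand F G) : Summand (sum E F) G :=
  (Provable.a2 E F G).trans (((Provable.refl E).congrSum h₂).trans h₁)

theorem left (E F : BExpr) : Summand E (BExpr.sum E F) :=
  (Provable.a2 E E F).symm.trans ((Provable.a3 E).congrSum (.refl F))

theorem right (E F : BExpr) : Summand F (BExpr.sum E F) :=
  (left F E).trans (of_provable (.a1 F E))

theorem nil (E : BExpr) : Summand nil E := (Provable.a1 _ E).trans (.a4 E)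

theorem tau (E : BExpr) : Summand E (act Act.tau E) := Provable.tau2 E

/-- Pre-emption in equational form: next to `τ.F`, (Pri6) puts `δ.E` under `pri`, and (Pri3) erases
it. -/
theorem delta_tau (E F : BExpr) : Summand (act Act.delta E) (act Act.tau F) :=
  (Provable.a1 _ _).trans <| (Provable.pri6 F _).trans <|
    ((Provable.refl _).congrSum (.pri3 E)).trans (.a4 _)

/-- (Tau3) applies once `E` is rewritten as `E + τ.F`; it absorbs a `τ` step that follows `γ`. -/
theorem act_of_tau (γ : Act) (h : Summand (act Act.tau F) E) : Summand (act γ F) (act γ E) := by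
  have hE : Provable E (BExpr.sum E (act Act.tau F)) := (Provable.symm h).trans (.a1 _ _)
  exact (of_provable (.refl _)).trans <| Summand.trans
    ((Provable.a1 _ _).trans (.tau3 γ E F)) (of_provable (Provable.congrAct γ hE.symm))

theorem pri (h : Summand E F) : Summand (pri E) (pri F) :=
  (Provable.pri4 E F).symm.trans (Provable.congrPri h)

theorem of_pStep {P P' : BExpr} {α : PAct} (h : PStep P α P') :
    Summand (act (Act.prio α) P') P := by
  induction h with
  | act α P => exact refl _
  | sumLeft _ ih => exact ih.trans (left _ _)
  | sumRight _ ih => exact ih.trans (right _ _)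
  | fix _ ih => exact ih.trans (of_provable (Provable.rec1 _).symm)
  | pri _ ih => exact (of_provable (Provable.pri2 _ _).symm).trans ih.pri

theorem of_dStep {P P' : BExpr} (h : DStep P P') : Summand (act Act.delta P') P := by
  induction h with
  | act P => exact refl _
  | sumLeft _ _ ih => exact ih.trans (left _ _)
  | sumRight _ _ ih => exact ih.trans (right _ _)
  | fix _ ih => exact ih.trans (of_provable (Provable.rec1 _).symm)

theorem of_step {P P' : BExpr} {γ : Act} (h : Step P γ P') : Summand (act γ P') P := by
  cases γ with
  | prio α => exact of_pStep h
  | delta => exact of_dStep h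

theorem of_tauStar {P Q : Proc} (h : Proc.TauStar P Q) : Summand Q.1 P.1 := by
  induction h with
  | refl => exact refl _
  | tail _ h ih => exact ((tau _).trans (of_step h)).trans ih

theorem act_of_tauStar {P Q : Proc} (γ : Act) (h : Proc.TauStar P Q) :
    Summand (act γ Q.1) (act γ P.1) := by
  induction h with
  | refl => exact refl _
  | tail _ h ih => exact (act_of_tau γ (of_step h)).trans ih

/-- Saturation: `τ` steps before `γ` are absorbed by (Tau2), those after it by (Tau3). -/
theorem of_weak {P Q : Proc} {γ : Act} (h : Proc.Weak P γ Q) : Summand (act γ Q.1) P.1 := by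
  obtain ⟨P', Q', h₁, h₂, h₃⟩ := h
  exact (act_of_tauStar γ h₃).trans ((of_step h₂).trans (of_tauStar h₁))

/-- A guarded basic process is the sum of its transitions: it is a summand of each expression that
has all its transitions as summands. -/
theorem of_forall_step (n : ℕ) :
    ∀ P F : BExpr, unguardedHeight P ≤ n → P.Closed → P.Basic → P.Guarded →
      (∀ γ P', Step P γ P' → Summand (act γ P') F) → Summand P F := by
  induction n using Nat.strong_induction_on with
  | _ n ih =>
    intro P F hn hc hb hg h
    cases P with
    | nil => exact nil F
    | var k => exact (hc k rfl).elim
    | act γ P =>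
      apply h γ P
      cases γ with
      | prio α => exact PStep.act α P
      | delta => exact DStep.act P
    | sum P Q =>
      simp only [unguardedHeight] at hn
      refine sum (ih (unguardedHeight P) (by omega) _ _ le_rfl
        (ComponentClosed.setOf_closed.sumLeft hc) hb.1 hg.1 ?_)
        (ih (unguardedHeight Q) (by omega) _ _ le_rfl
        (ComponentClosed.setOf_closed.sumRight hc) hb.2 hg.2 ?_)
      · rintro (α | _) P' hP'
        · exact h (Act.prio α) P' (PStep.sumLeft hP')
        · by_cases hQ : ∃ Q', PStep Q PAct.tau Q'
          · obtain ⟨Q', hQ'⟩ := hQ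
            -- The sum lacks this `δ` transition, but it has the pre-empting `τ` transition, whose
            -- prefix absorbs it.
            exact (delta_tau P' Q').trans (h Act.tau Q' (PStep.sumRight hQ'))
          · exact h Act.delta P' (DStep.sumLeft hP' hQ)
      · rintro (α | _) Q' hQ'
        · exact h (Act.prio α) Q' (PStep.sumRight hQ')
        · by_cases hP : ∃ P', PStep P PAct.tau P'
          · obtain ⟨P', hP'⟩ := hP
            exact (delta_tau Q' P').trans (h Act.tau P' (PStep.sumLeft hP'))
          · exact h Act.delta Q' (DStep.sumRight hQ' hP)
    | fix E =>
      refine (of_provable (Provable.rec1 E)).trans (ih _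
        ((unguardedHeight_inst_fix hg).trans_le hn) _ _ le_rfl hc.inst_fix hb.inst_fix
        hg.inst_fix ?_)
      rintro (α | _) P' hP'
      · exact h (Act.prio α) P' (PStep.fix hP')
      · exact h Act.delta P' (DStep.fix hP')
    | pri P => exact hb.elim

theorem of_forall_trans {P : Proc} {F : BExpr} (hg : P.1.Guarded)
    (h : ∀ γ P', Proc.Trans P γ P' → Summand (act γ P'.1) F) : Summand P.1 F :=
  of_forall_step _ P.1 F le_rfl P.2.1 P.2.2 hg fun γ P' hP' =>
    h γ ⟨P', ComponentClosed.setOf_closed.mem_of_step hP' P.2.1,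
      ComponentClosed.setOf_basic.mem_of_step hP' P.2.2⟩ hP'

end Summand

/-! ### Finite sums of prefixed expressions -/

/-- The sum of a list of prefixed expressions. -/
def sumOf : List (Act × BExpr) → BExpr
  | [] => nil
  | x :: l => sum (act x.1 x.2) (sumOf l)

theorem Summand.of_mem {l : List (Act × BExpr)} {x : Act × BExpr} (h : x ∈ l) :
    Summand (act x.1 x.2) (sumOf l) := by
  induction l with
  | nil => cases h
  | cons y l ih =>
    rcases List.mem_cons.1 h with rfl | h
    · exact Summand.left _ _
    · exact (ih h).trans (Summand.right _ _)

theorem Summand.sumOf {l : List (Act × BExpr)} {F : BExpr}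
    (h : ∀ x ∈ l, Summand (act x.1 x.2) F) : Summand (sumOf l) F := by
  induction l with
  | nil => exact Summand.nil F
  | cons y l ih =>
    exact Summand.sum (h y List.mem_cons_self) (ih fun x hx => h x (List.mem_cons_of_mem _ hx))

theorem Provable.sumOf_map {ι : Type*} (l : List ι) {f g : ι → Act × BExpr}
    (h : ∀ i ∈ l, Provable (act (f i).1 (f i).2) (act (g i).1 (g i).2)) :
    Provable (sumOf (l.map f)) (sumOf (l.map g)) := by
  induction l with
  | nil => exact .refl _
  | cons i l ih =>
    exact (h i List.mem_cons_self).congrSum (ih fun j hj => h j (List.mem_cons_of_mem _ hj))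

theorem subst_sumOf (s : ℕ → BExpr) (l : List (Act × BExpr)) :
    subst s (sumOf l) = sumOf (l.map fun x => (x.1, subst s x.2)) := by
  induction l with
  | nil => rfl
  | cons x l ih => simp only [sumOf, subst, ih, List.map]

theorem basic_sumOf {l : List (Act × BExpr)} (h : ∀ x ∈ l, x.2.Basic) : (sumOf l).Basic := by
  induction l with
  | nil => trivial
  | cons x l ih =>
    exact ⟨h x List.mem_cons_self, ih fun y hy => h y (List.mem_cons_of_mem _ hy)⟩

theorem guardedVar_sumOf {k : ℕ} {l : List (Act × BExpr)}
    (h : ∀ x ∈ l, x.1 = Act.tau → GuardedVar k x.2) : GuardedVar k (sumOf l) := by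
  induction l with
  | nil => trivial
  | cons x l ih =>
    refine ⟨?_, ih fun y hy => h y (List.mem_cons_of_mem _ hy)⟩
    by_cases hx : x.1 = Act.tau
    · exact Or.inr (h x List.mem_cons_self hx)
    · exact Or.inl hx

/-! ### Unique solutions of finite guarded systems -/

/-- The substitution of values for the states on a stack. -/
def stackSubst {S : Type*} (A : S → BExpr) : List S → ℕ → BExpr
  | [] => fun _ => nil
  | s :: st => cons (A s) (stackSubst A st)

theorem basic_stackSubst {S : Type*} {A : S → BExpr} (hA : ∀ s, (A s).Basic) (st : List S) :
    ∀ k, (stackSubst A st k).Basic := by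
  induction st with
  | nil => intro k; trivial
  | cons s st ih =>
    intro k
    cases k with
    | zero => exact hA s
    | succ k => exact ih k

section System

variable {S : Type*} [DecidableEq S] (T : S → List (Act × S))

/-- The expression for the state `t` of a finite transition system, where the variables with the
smallest indices stand for the states on the stack. The first argument bounds the depth. -/
def solution : ℕ → List S → S → BExpr
  | 0, _, _ => nil
  | n + 1, st, t => fix (sumOf ((T t).map fun x =>
      (x.1, if x.2 ∈ t :: st then var ((t :: st).idxOf x.2) else solution n (t :: st) x.2)))

theorem basic_solution (n : ℕ) : ∀ (st : List S) (t : S), (solution T n st t).Basic := by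
  induction n with
  | zero => intro st t; trivial
  | succ n ih =>
    intro st t
    refine basic_sumOf fun x hx => ?_
    obtain ⟨y, _, rfl⟩ := List.mem_map.1 hx
    dsimp only
    split_ifs
    · trivial
    · exact ih _ _

variable {T} {μ : S → ℕ}

/-- A `τ` edge strictly lowers `μ`, so from a state of measure at most `μ s` no `τ` edge leads back
to `s`: the variable of `s` is met only below other prefixes. -/
theorem guardedVar_solution_body {t s : S} {st : List S} (hs : s ∈ t :: st)
    (hμ : ∀ t t', (Act.tau, t') ∈ T t → μ t' < μ t) (hts : μ t ≤ μ s) {f : S → BExpr}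
    (hf : ∀ t', t' ∉ t :: st → μ t' ≤ μ s → GuardedVar ((t :: st).idxOf s) (f t')) :
    GuardedVar ((t :: st).idxOf s) (sumOf ((T t).map fun x =>
      (x.1, if x.2 ∈ t :: st then var ((t :: st).idxOf x.2) else f x.2))) := by
  refine guardedVar_sumOf fun x hx hτ => ?_
  obtain ⟨⟨γ, t'⟩, hy, rfl⟩ := List.mem_map.1 hx
  dsimp only at hτ ⊢
  subst hτ
  have hlt := (hμ t t' hy).trans_le hts
  split_ifs with hmem
  · intro heq
    have := (List.idxOf_inj hmem).1 heq
    subst this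
    exact lt_irrefl _ hlt
  · exact hf t' hmem hlt.le

theorem guardedVar_solution (hμ : ∀ t t', (Act.tau, t') ∈ T t → μ t' < μ t) (n : ℕ) :
    ∀ (st : List S) (t s : S), s ∈ st → μ t ≤ μ s → t ∉ st →
      GuardedVar (st.idxOf s) (solution T n st t) := by
  induction n with
  | zero => intros; trivial
  | succ n ih =>
    intro st t s hs hts ht
    have hne : t ≠ s := fun h => ht (h ▸ hs)
    have hidx : (t :: st).idxOf s = st.idxOf s + 1 := List.idxOf_cons_ne _ hne
    change GuardedVar (st.idxOf s + 1) _
    rw [← hidx]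
    exact guardedVar_solution_body (List.mem_cons_of_mem _ hs) hμ hts fun t' ht' hμ' =>
      ih _ _ _ (List.mem_cons_of_mem _ hs) hμ' ht'

theorem stackSubst_idxOf (A : S → BExpr) {s : S} {st : List S} (h : s ∈ st) :
    stackSubst A st (st.idxOf s) = A s := by
  induction st with
  | nil => cases h
  | cons t st ih =>
    by_cases hts : t = s
    · subst hts
      rw [List.idxOf_cons_self]
      rfl
    · rw [List.idxOf_cons_ne _ hts]
      exact ih ((List.mem_cons.1 h).resolve_left fun h => hts h.symm)

/-- Any family satisfying the equations equals the syntactic solution in which the states on the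
stack still take their values from that family. -/
theorem provable_subst_solution [Fintype S]
    (hμ : ∀ t t', (Act.tau, t') ∈ T t → μ t' < μ t) {A : S → BExpr} (hb : ∀ s, (A s).Basic)
    (hA : ∀ t, Provable (A t) (sumOf ((T t).map fun x => (x.1, A x.2)))) (n : ℕ) :
    ∀ (st : List S) (t : S), t ∉ st → st.Nodup → Fintype.card S ≤ n + st.length →
      Provable (A t) (subst (stackSubst A st) (solution T n st t)) := by
  induction n with
  | zero =>
    intro st t ht hst hn
    -- The default `nil` at depth `0` is never reached: the stack would already hold every state,
    -- leaving no room for `t`.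
    have := (List.nodup_cons.2 ⟨ht, hst⟩).length_le_card
    simp only [List.length_cons] at this
    omega
  | succ n ih =>
    intro st t ht hst hn
    have hst' : (t :: st).Nodup := List.nodup_cons.2 ⟨ht, hst⟩
    refine Provable.rec2 (Basic.serial (Basic.subst ?_ _ fun k => ?_) 0)
      (guardedVar_zero_subst_up ?_ _) ?_
    · exact basic_solution T (n + 1) st t
    · cases k with
      | zero => trivial
      | succ k => exact (basic_stackSubst hb st k).rename _
    · have h := guardedVar_solution_body (st := st) (s := t) List.mem_cons_self hμ le_rfl
        (f := solution T n (t :: st)) fun t' ht' hμ' =>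
          guardedVar_solution hμ n _ _ _ List.mem_cons_self hμ' ht'
      rwa [List.idxOf_cons_self] at h
    -- The (Rec2) premise is the equation for `t`, with `A t` pushed on the stack: states on the
    -- stack are looked up, the others fall to the induction hypothesis.
    · rw [inst_subst_up, subst_sumOf, List.map_map]
      refine (hA t).trans (Provable.sumOf_map _ fun x _ => Provable.congrAct _ ?_)
      dsimp only [Function.comp]
      split_ifs with hx
      · have h := stackSubst_idxOf A hx
        simp only [subst]
        exact h ▸ Provable.refl _
      · refine ih (t :: st) x.2 hx hst' ?_
        simp only [List.length_cons]
        omega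

/-- A finite system of equations without cycles of unguarded `τ` prefixes has at most one
solution up to provable equality. -/
theorem provable_of_solutions [Finite S]
    (hμ : ∀ t t', (Act.tau, t') ∈ T t → μ t' < μ t) {A B : S → BExpr}
    (hbA : ∀ s, (A s).Basic) (hbB : ∀ s, (B s).Basic)
    (hA : ∀ t, Provable (A t) (sumOf ((T t).map fun x => (x.1, A x.2))))
    (hB : ∀ t, Provable (B t) (sumOf ((T t).map fun x => (x.1, B x.2)))) (t : S) :
    Provable (A t) (B t) := by
  have := Fintype.ofFinite S
  -- On the empty stack `stackSubst` does not depend on the family, so `A t` and `B t` are both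
  -- equal to the same expression.
  exact (provable_subst_solution hμ hbA hA (Fintype.card S) [] t List.not_mem_nil
    List.nodup_nil le_rfl).trans (provable_subst_solution hμ hbB hB (Fintype.card S) [] t
    List.not_mem_nil List.nodup_nil le_rfl).symm

end System

/-! ### The joint system of two processes -/

namespace Proc

theorem WeakBisimilar.symm {P Q : Proc} (h : WeakBisimilar P Q) : WeakBisimilar Q P := by
  obtain ⟨β, hβ, h⟩ := h
  exact ⟨fun P Q => β Q P, fun P Q hPQ => ⟨(hβ Q P hPQ).2, (hβ Q P hPQ).1⟩, h⟩

theorem WeakBisimilar.exists_weakHat {P Q P' : Proc} {γ : Act} (h : WeakBisimilar P Q)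
    (hP : Trans P γ P') : ∃ Q', WeakHat Q γ Q' ∧ WeakBisimilar P' Q' := by
  obtain ⟨β, hβ, h⟩ := h
  obtain ⟨Q', hQ', h'⟩ := (hβ P Q h).1 γ P' hP
  exact ⟨Q', hQ', β, hβ, h'⟩

theorem ObsCongr.symm {P Q : Proc} (h : ObsCongr P Q) : ObsCongr Q P :=
  ⟨fun γ Q' hQ' => (h.2 γ Q' hQ').imp fun _ h => ⟨h.1, h.2.symm⟩,
    fun γ P' hP' => (h.1 γ P' hP').imp fun _ h => ⟨h.1, h.2.symm⟩⟩

theorem Weak.of_trans {P Q : Proc} {γ : Act} (h : Trans P γ Q) : Weak P γ Q :=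
  ⟨P, Q, .refl, h, .refl⟩

theorem TauStar.eq_or_weak {P Q : Proc} (h : TauStar P Q) : Q = P ∨ Weak P Act.tau Q := by
  rcases Relation.ReflTransGen.cases_head h with h | ⟨R, hPR, hRQ⟩
  · exact Or.inl h.symm
  · exact Or.inr ⟨P, R, .refl, hPR, hRQ⟩

theorem TauStar.unguardedHeight_le {P Q : Proc} (h : TauStar P Q) (hP : P.1.Guarded) :
    unguardedHeight Q.1 ≤ unguardedHeight P.1 := by
  induction h with
  | refl => exact le_rfl
  | tail h₁ h₂ ih =>
    exact (PStep.unguardedHeight_lt h₂ rfl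
      (ComponentClosed.setOf_guarded.mem_of_tauStar h₁ hP)).le.trans ih

theorem Weak.unguardedHeight_lt {P Q : Proc} (h : Weak P Act.tau Q) (hP : P.1.Guarded) :
    unguardedHeight Q.1 < unguardedHeight P.1 := by
  obtain ⟨P', Q', h₁, h₂, h₃⟩ := h
  have hP' := ComponentClosed.setOf_guarded.mem_of_tauStar h₁ hP
  have hQ' := ComponentClosed.setOf_guarded.mem_of_step h₂ hP'
  exact (h₃.unguardedHeight_le hQ').trans_lt
    ((PStep.unguardedHeight_lt h₂ rfl hP').trans_le (h₁.unguardedHeight_le hP))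

/-- Joint weak transitions of two processes, where a `τ` transition of one of them may be matched
by inaction of the other. -/
def Joint (P Q : Proc) (γ : Act) (P' Q' : Proc) : Prop :=
  WeakBisimilar P' Q' ∧ ((Weak P γ P' ∧ Weak Q γ Q') ∨
    (γ = Act.tau ∧ Weak P γ P' ∧ Q' = Q) ∨ (γ = Act.tau ∧ P' = P ∧ Weak Q γ Q'))

theorem Joint.symm {P Q P' Q' : Proc} {γ : Act} (h : Joint P Q γ P' Q') : Joint Q P γ Q' P' := by
  obtain ⟨h, ⟨h₁, h₂⟩ | ⟨h₀, h₁, h₂⟩ | ⟨h₀, h₁, h₂⟩⟩ := h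
  · exact ⟨h.symm, Or.inl ⟨h₂, h₁⟩⟩
  · exact ⟨h.symm, Or.inr (Or.inr ⟨h₀, h₂, h₁⟩)⟩
  · exact ⟨h.symm, Or.inr (Or.inl ⟨h₀, h₂, h₁⟩)⟩

/-- At least one side really performs a `τ` step, even when the other idles; hence the sum of
heights can serve as the measure of the joint system. -/
theorem Joint.unguardedHeight_lt {P Q P' Q' : Proc} (h : Joint P Q Act.tau P' Q')
    (hP : P.1.Guarded) (hQ : Q.1.Guarded) :
    unguardedHeight P'.1 + unguardedHeight Q'.1 < unguardedHeight P.1 + unguardedHeight Q.1 := by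
  obtain ⟨_, ⟨h₁, h₂⟩ | ⟨_, h₁, rfl⟩ | ⟨_, rfl, h₂⟩⟩ := h
  · have := h₁.unguardedHeight_lt hP
    have := h₂.unguardedHeight_lt hQ
    omega
  · have := h₁.unguardedHeight_lt hP
    omega
  · have := h₂.unguardedHeight_lt hQ
    omega

theorem Joint.mem_left {I : Set BExpr} (hI : ComponentClosed I) {P Q P' Q' : Proc} {γ : Act}
    (h : Joint P Q γ P' Q') (hP : P.1 ∈ I) : P'.1 ∈ I := by
  obtain ⟨_, ⟨h₁, _⟩ | ⟨_, h₁, _⟩ | ⟨_, rfl, _⟩⟩ := h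
  · exact (hI.mem_of_weak h₁ hP).1
  · exact (hI.mem_of_weak h₁ hP).1
  · exact hP

theorem Joint.exists_act_mem {I J : Set BExpr} (hI : ComponentClosed I) (hJ : ComponentClosed J)
    {P Q P' Q' : Proc} {γ : Act} (h : Joint P Q γ P' Q') (hP : P.1 ∈ I) (hQ : Q.1 ∈ J) :
    ∃ E, act γ E ∈ I ∪ J := by
  obtain ⟨_, ⟨h₁, _⟩ | ⟨_, h₁, _⟩ | ⟨_, _, h₂⟩⟩ := h
  · exact (hI.mem_of_weak h₁ hP).2.imp fun _ => Or.inl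
  · exact (hI.mem_of_weak h₁ hP).2.imp fun _ => Or.inl
  · exact (hJ.mem_of_weak h₂ hQ).2.imp fun _ => Or.inr

open Classical in
/-- The solution that `P` gives for the state `(P, Q)` of the joint system: it is `τ.P` if `Q` has
a `τ` transition that `P` matches by inaction. -/
noncomputable def rep (P Q : Proc) : BExpr :=
  if ∃ Q', Joint P Q Act.tau P Q' ∧ Weak Q Act.tau Q' then act Act.tau P.1 else P.1

theorem basic_rep (P Q : Proc) : (rep P Q).Basic := by
  unfold rep
  split_ifs
  · exact P.2.2
  · exact P.2.2

theorem provable_act_rep (γ : Act) (P Q : Proc) : Provable (act γ (rep P Q)) (act γ P.1) := by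
  unfold rep
  split_ifs
  · exact .tau1 _ _
  · exact .refl _

/-- Each transition of `P` occurs in a joint one by bisimilarity, so `P` is a summand of the right
side. Conversely, joint transitions in which `P` moves give summands of `P` by saturation. Those in
which `P` idles contribute `τ.P`, which is why `rep` adds the prefix exactly when they exist. -/
theorem provable_rep {P Q : Proc} (hP : P.1.Guarded) (h : WeakBisimilar P Q)
    {l : List (Act × BExpr)}
    (hl : ∀ x, x ∈ l ↔ ∃ P' Q', Joint P Q x.1 P' Q' ∧ x.2 = rep P' Q') :
    Provable (rep P Q) (sumOf l) := by
  have hmem : ∀ {γ P' Q'}, Joint P Q γ P' Q' → Summand (act γ P'.1) (sumOf l) :=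
    fun {γ P' Q'} hj => (Summand.of_provable (provable_act_rep γ P' Q').symm).trans
      (Summand.of_mem (x := (γ, rep P' Q')) ((hl _).2 ⟨P', Q', hj, rfl⟩))
  have hle : Summand P.1 (sumOf l) := by
    refine Summand.of_forall_trans hP fun γ P' hP' => ?_
    obtain ⟨Q', hQ', h'⟩ := h.exists_weakHat hP'
    rcases hQ' with ⟨_, hQ'⟩ | ⟨rfl, hQ'⟩
    · exact hmem ⟨h', Or.inl ⟨.of_trans hP', hQ'⟩⟩
    · rcases hQ'.eq_or_weak with rfl | hQ'
      · exact hmem ⟨h', Or.inr (Or.inl ⟨rfl, .of_trans hP', rfl⟩)⟩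
      · exact hmem ⟨h', Or.inl ⟨.of_trans hP', hQ'⟩⟩
  unfold rep
  split_ifs with hτ
  · obtain ⟨Q', hj, _⟩ := hτ
    -- The idle move supplies `τ.P` as a summand; all other summands lie below `P`, hence below
    -- `τ.P`.
    refine (hmem hj).antisymm (Summand.sumOf fun x hx => ?_)
    obtain ⟨P', Q', hj, hx⟩ := (hl x).1 hx
    rw [hx]
    refine (Summand.of_provable (provable_act_rep _ _ _)).trans ?_
    obtain ⟨_, ⟨h₁, _⟩ | ⟨_, h₁, _⟩ | ⟨h₀, rfl, _⟩⟩ := hj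
    · exact (Summand.of_weak h₁).trans (.tau _)
    · exact (Summand.of_weak h₁).trans (.tau _)
    · rw [h₀]
      exact .refl _
  · refine hle.antisymm (Summand.sumOf fun x hx => ?_)
    obtain ⟨P', Q', hj, hx⟩ := (hl x).1 hx
    rw [hx]
    refine (Summand.of_provable (provable_act_rep _ _ _)).trans ?_
    obtain ⟨h', ⟨h₁, _⟩ | ⟨_, h₁, _⟩ | ⟨h₀, rfl, h₂⟩⟩ := hj
    · exact Summand.of_weak h₁
    · exact Summand.of_weak h₁
    · rw [h₀] at h₂
      exact (hτ ⟨Q', ⟨h', Or.inr (Or.inr ⟨rfl, rfl, h₂⟩)⟩, h₂⟩).elim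

/-- Weakly bisimilar guarded processes give provably equal solutions of the joint system. -/
theorem WeakBisimilar.provable_rep_comm {P Q : Proc} (hP : P.1.Guarded) (hQ : Q.1.Guarded)
    (h : WeakBisimilar P Q) : Provable (rep P Q) (rep Q P) := by
  classical
  obtain ⟨I, hIf, hPI, hI⟩ := ComponentClosed.exists_finite P.1
  obtain ⟨J, hJf, hQJ, hJ⟩ := ComponentClosed.exists_finite Q.1
  have hIg := hI.inter ComponentClosed.setOf_guarded
  have hJg := hJ.inter ComponentClosed.setOf_guarded
  let S := {x : Proc × Proc // (x.1.1 ∈ I ∩ {E | E.Guarded} ∧ x.2.1 ∈ J ∩ {E | E.Guarded}) ∧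
    WeakBisimilar x.1 x.2}
  have hS : Finite S := by
    have := hIf.to_subtype
    have := hJf.to_subtype
    refine Finite.of_injective
      (fun s : S => ((⟨_, s.2.1.1.1⟩, ⟨_, s.2.1.2.1⟩) : I × J)) fun s t hst => ?_
    simp only [Prod.mk.injEq, Subtype.mk.injEq] at hst
    exact Subtype.ext (Prod.ext (Subtype.ext hst.1) (Subtype.ext hst.2))
  let R : S → Set (Act × S) := fun s => {x | Joint s.1.1 s.1.2 x.1 x.2.1.1 x.2.1.2}
  have hR : ∀ s, (R s).Finite := by
    intro s
    -- `Act` is infinite, but only labels of prefixes in `I ∪ J` can occur. The default label `τ` in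
    -- the image below is harmless.
    have hacts : {γ : Act | ∃ E, act γ E ∈ I ∪ J}.Finite := by
      refine ((hIf.union hJf).image fun G => match G with
        | act γ _ => γ
        | _ => Act.tau).subset ?_
      rintro γ ⟨E, hE⟩
      exact ⟨_, hE, rfl⟩
    refine (hacts.prod (Set.finite_univ (α := S))).subset fun x hx => ⟨?_, trivial⟩
    exact hx.exists_act_mem hI hJ s.2.1.1.1 s.2.1.2.1
  let T : S → List (Act × S) := fun s => (hR s).toFinset.toList
  have hT : ∀ s x, x ∈ T s ↔ Joint s.1.1 s.1.2 x.1 x.2.1.1 x.2.1.2 := fun s x => by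
    simp [T, R]
  have hnext : ∀ (s : S) {γ P' Q'}, Joint s.1.1 s.1.2 γ P' Q' →
      ∃ t : S, t.1 = (P', Q') := fun s γ P' Q' hj =>
    ⟨⟨(P', Q'), ⟨hj.mem_left hIg s.2.1.1, hj.symm.mem_left hJg s.2.1.2⟩, hj.1⟩, rfl⟩
  refine provable_of_solutions (T := T)
    (μ := fun s => unguardedHeight s.1.1.1 + unguardedHeight s.1.2.1) ?_
    (A := fun s => rep s.1.1 s.1.2) (B := fun s => rep s.1.2 s.1.1)
    (fun s => basic_rep _ _) (fun s => basic_rep _ _) ?_ ?_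
    ⟨(P, Q), ⟨⟨hPI, hP⟩, ⟨hQJ, hQ⟩⟩, h⟩
  · intro s t hst
    exact ((hT s _).1 hst).unguardedHeight_lt s.2.1.1.2 s.2.1.2.2
  · intro s
    refine provable_rep s.2.1.1.2 s.2.2 fun x => ⟨fun hx => ?_, ?_⟩
    · obtain ⟨y, hy, rfl⟩ := List.mem_map.1 hx
      exact ⟨_, _, (hT s y).1 hy, rfl⟩
    · rintro ⟨P', Q', hj, hx⟩
      obtain ⟨t, ht⟩ := hnext s hj
      refine List.mem_map.2 ⟨(x.1, t), (hT s _).2 ?_, ?_⟩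
      · simpa only [ht] using hj
      · exact Prod.ext rfl (by simp only [ht, hx])
  · intro s
    -- Joint transitions are symmetric in the two processes, so the second components solve the same
    -- system with roles exchanged.
    refine provable_rep s.2.1.2.2 s.2.2.symm fun x => ⟨fun hx => ?_, ?_⟩
    · obtain ⟨y, hy, rfl⟩ := List.mem_map.1 hx
      exact ⟨_, _, ((hT s y).1 hy).symm, rfl⟩
    · rintro ⟨Q', P', hj, hx⟩
      obtain ⟨t, ht⟩ := hnext s hj.symm
      refine List.mem_map.2 ⟨(x.1, t), (hT s _).2 ?_, ?_⟩
      · simpa only [ht] using hj.symm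
      · exact Prod.ext rfl (by simp only [ht, hx])

theorem WeakBisimilar.provable_act {P Q : Proc} (hP : P.1.Guarded) (hQ : Q.1.Guarded)
    (h : WeakBisimilar P Q) (γ : Act) : Provable (act γ P.1) (act γ Q.1) :=
  (provable_act_rep γ P Q).symm.trans
    ((Provable.congrAct γ (h.provable_rep_comm hP hQ)).trans (provable_act_rep γ Q P))

/-- Observational congruence answers even an initial `τ` by a real weak transition, so no `τ` prefix
has to be added at the root. -/
theorem ObsCongr.summand {P Q : Proc} (hP : P.1.Guarded) (hQ : Q.1.Guarded)
    (h : ObsCongr P Q) : Summand P.1 Q.1 := by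
  refine Summand.of_forall_trans hP fun γ P' hP' => ?_
  obtain ⟨Q', hQ', h'⟩ := h.1 γ P' hP'
  exact (Summand.of_provable (h'.provable_act
    (ComponentClosed.setOf_guarded.mem_of_step hP' hP)
    (ComponentClosed.setOf_guarded.mem_of_weak hQ' hQ).1 γ)).trans (Summand.of_weak hQ')

end Proc

end PrioCalculus

theorem mainTheorem5 (P Q : PrioCalculus.Proc)
    (hP : P.1.Guarded) (hQ : Q.1.Guarded)
    (h : PrioCalculus.Proc.ObsCongr P Q) :
    PrioCalculus.Provable P.1 Q.1 :=
  (h.summand hP hQ).antisymm (h.symm.summand hQ hP)
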